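/- **Theorem (Duality for DCA + Ax).** *Algebras.* Let $B$ be a Boolean algebra with operations $+,\cdot,{}^*$. A relation $C$ on $B$ is a *precontact* relation if (C1) $aCb$ implies $a\ne 0$ and $b\ne 0$; (C2) $aCb$, $a\le a'$, $b\le b'$ imply $a'Cb'$; (C3) $aC(b+c)$ implies $aCb$ or $aCc$, and $(a+b)Cc$ implies $aCc$ or $bCc$. It is a *contact* relation if moreover (C4) $aCb$ implies $bCa$, and (C5) $a\cdot b\neq 0$ implies $aCb$. A *clan* of a contact relation $C$ is a set $\Gamma\subseteq B$ with $1\in\Gamma$, $0\notin\Gamma$, which is upward closed, such that $a+b\in\Gamma$ implies $a\in\Gamma$ or $b\in\Gamma$, and such that $aCb$ for all $a,b\in\Gamma$. A *cluster* is a clan $\Gamma$ such that for every $a\notin\Gamma$ there is $b\in\Gamma$ with $a\overline{C}b$ (a bar denotes the complement of a relation). A *dynamic contact algebra* (DCA) is $A=(B,C^s,C^t,\mathcal B)$ where $B$ is a Boolean algebra with $0\ne1$, $C^s$ and $C^t$ are contact relations on $B$, $\mathcal B$ is a precontact relation on $B$, and for all $a,b\in B$: $aC^sb$ implies $aC^tb$;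 if $a\overline{C^t}b$ then there is $c$ with $a\overline{C^t}c$ and $c^*\overline{C^t}b$; if $a\overline{\mathcal B}b$ then there is $c$ with $a\overline{C^t}c$ and $c^*\overline{\mathcal B}b$; if $a\overline{\mathcal B}b$ then there is $c$ with $a\overline{\mathcal B}c$ and $c^*\overline{C^t}b$. A morphism of DCAs $A_1\to A_2$ is a Boolean homomorphism $f$ such that, for each $R\in\{C^s,C^t,\mathcal B\}$, $f(a)\,R_{A_2}\,f(b)$ implies $a\,R_{A_1}\,b$. The t-clans and s-clans of $A$ are the clans of $C^t$ and of $C^s$; the clusters of $A$ are the clusters of $C^t$. *Spaces.* For a topological space $X$ let $RC(X)$ be the Boolean algebra of regular closed subsets of $X$ (sets $a$ with $a=\mathrm{Cl}\,\mathrm{Int}\,a$), ordered by inclusion, with $a+b=a\cup b$, $a\cdot b=\mathrm{Cl}\,\mathrm{Int}(a\cap b)$, $a^*=\mathrm{Cl}(X\setminus a)$. A *dynamic mereotopological space* (DMS) is $S=(X^t,X^s,T,\prec,M)$ where $X^t$ is a nonempty topological space, $X^s$ and $T$ are nonempty subsets of $X^t$, $\prec$ is a binary relation on $X^t$, and $M$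 is a Boolean subalgebra of $RC(X^t)$ that is a closed base of the topology of $X^t$, such that, writing for $a,b\in RC(X^t)$ $$aC^t_Sb\iff a\cap b\neq\varnothing,\qquad aC^s_Sb\iff a\cap b\cap X^s\ne\varnothing,\qquad a\mathcal B_Sb\iff \exists x\in a\ \exists y\in b:\ x\prec y,$$ the following hold: every nonempty $a\in RC(X^t)$ meets $X^s$; $S^+=(M,C^s_S,C^t_S,\mathcal B_S)$ is a DCA; for all $x,y\in X^t$, $x\prec y$ if and only if $a\mathcal B_Sb$ for all $a,b\in M$ with $x\in a$, $y\in b$; and for every $x\in T$ the set $\rho_S(x)=\{a\in M: x\in a\}$ is a cluster of $S^+$. A morphism of DMSes $S\to S'$ is a map $\theta:X^t_S\to X^t_{S'}$ with $\theta(X^s_S)\subseteq X^s_{S'}$, with $x\prec_S y\Rightarrow\theta(x)\prec_{S'}\theta(y)$, and such that $a\mapsto\theta^{-1}(a)$ maps $M_{S'}$ into $M_S$ and is a homomorphism of Boolean algebras $M_{S'}\to M_S$. $S$ is *T0* if $X^t$ is a $T_0$ space, and *DM-compact* if every t-clan, every s-clan and every cluster of $S^+$ is of the form $\rho_S(x)$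 with, respectively, $x\in X^t$, $x\in X^s$, $x\in T$. *Time axioms and time conditions.* Consider the following ten axioms on a DCA (for all $a,b,p\in B$), each paired with a condition on a structure $(T,\prec)$ (for all $i,j,k\in T$): - (rs) $a\ne0\Rightarrow a\mathcal B1$; (RS) $\exists n:\ i\prec n$. - (ls) $a\ne0\Rightarrow 1\mathcal Ba$; (LS) $\exists n:\ n\prec i$. - (up dir) $a,b\ne0\Rightarrow a\mathcal Bp$ or $b\mathcal Bp^*$; (Up Dir) $\exists n:\ i\prec n$ and $j\prec n$. - (down dir) $a,b\ne0\Rightarrow p\mathcal Ba$ or $p^*\mathcal Bb$; (Down Dir) $\exists n:\ n\prec i$ and $n\prec j$. - (circ) $a\mathcal Bb\Rightarrow b\mathcal Bp$ or $p^*\mathcal Ba$; (Circ) $i\prec j\Rightarrow\exists n:\ j\prec n$ and $n\prec i$. - (dens) $a\mathcal Bb\Rightarrow a\mathcal Bp$ or $p^*\mathcal Bb$; (Dens) $i\prec j\Rightarrow\exists n:\ i\prec n$ and $n\prec j$. - (ref) $aC^tb\Rightarrow a\mathcal Bb$; (Ref) $i\prec i$. - (lin) $a,b\ne0\Rightarrow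 a\mathcal Bb$ or $b\mathcal Ba$; (Lin) $i\prec j$ or $j\prec i$. - (tri) $a,b\ne0\Rightarrow aC^tb$ or $a\mathcal Bb$ or $b\mathcal Ba$; (Tri) $i=j$ or $i\prec j$ or $j\prec i$. - (tr) $a\overline{\mathcal B}b\Rightarrow\exists c:\ a\overline{\mathcal B}c$ and $c^*\overline{\mathcal B}b$; (Tr) $i\prec j$ and $j\prec k$ imply $i\prec k$. Let $Ax$ be any subset of the ten time axioms and $\widehat{Ax}$ the set of the corresponding time conditions. Let $\mathbf{DCA}(Ax)$ be the full subcategory of the category of DCAs and DCA-morphisms whose objects are the DCAs satisfying $Ax$, and let $\mathbf{DMS}(\widehat{Ax})^*$ be the full subcategory of the category of DMSes and DMS-morphisms whose objects are the T0, DM-compact DMSes $S$ whose time structure $(T_S,\prec_S)$ (with $\prec_S$ restricted to $T_S$) satisfies $\widehat{Ax}$. Then $\mathbf{DCA}(Ax)$ is dually equivalent to $\mathbf{DMS}(\widehat{Ax})^*$, that is, the opposite category of $\mathbf{DCA}(Ax)$ is equivalent to $\mathbf{DMS}(\widehat{Ax})^*$. -/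

import Mathlib

open CategoryTheory

universe u

namespace DynMereo

/-! ### Precontact and contact relations, clans and clusters -/

section Contact

/-- A precontact relation in a Boolean algebra: (C1), (C2), (C3'), (C3''). -/
structure IsPrecontact {B : Type u} [BooleanAlgebra B] (C : B → B → Prop) : Prop where
  ne_bot : ∀ a b, C a b → a ≠ ⊥ ∧ b ≠ ⊥
  mono : ∀ a b a' b', C a b → a ≤ a' → b ≤ b' → C a' b'
  sup_right : ∀ a b c, C a (b ⊔ c) → C a b ∨ C a c
  sup_left : ∀ a b c, C (a ⊔ b) c → C a c ∨ C b c

/-- A contact relation: a precontact relation with (C4) and (C5). -/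
structure IsContact {B : Type u} [BooleanAlgebra B] (C : B → B → Prop) : Prop
    extends IsPrecontact C where
  symm : ∀ a b, C a b → C b a
  overlap : ∀ a b, a ⊓ b ≠ ⊥ → C a b

/-- Clans of the relation `C`: grills any two of whose members are in contact. -/
structure IsClan {B : Type u} [BooleanAlgebra B] (C : B → B → Prop) (Γ : Set B) : Prop where
  top_mem : ⊤ ∈ Γ
  bot_notMem : ⊥ ∉ Γ
  up : ∀ a b, a ∈ Γ → a ≤ b → b ∈ Γ
  prime : ∀ a b, a ⊔ b ∈ Γ → a ∈ Γ ∨ b ∈ Γ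
  contact : ∀ a b, a ∈ Γ → b ∈ Γ → C a b

/-- Clusters of the relation `C`. -/
structure IsCluster {B : Type u} [BooleanAlgebra B] (C : B → B → Prop) (Γ : Set B) : Prop
    extends IsClan C Γ where
  cluster : ∀ a, a ∉ Γ → ∃ b ∈ Γ, ¬ C a b

end Contact

/-! ### Dynamic contact algebras -/

section DCA

/-- The axioms of a dynamic contact algebra with space contact `Cs`, time contact `Ct` and
local precedence `Bp`. -/
structure IsDCA {B : Type u} [BooleanAlgebra B] (Cs Ct Bp : B → B → Prop) : Prop where
  nondegenerate : (⊥ : B) ≠ ⊤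
  contact_space : IsContact Cs
  contact_time : IsContact Ct
  space_le_time : ∀ a b, Cs a b → Ct a b
  efremovich : ∀ a b, ¬ Ct a b → ∃ c, ¬ Ct a c ∧ ¬ Ct cᶜ b
  precontact : IsPrecontact Bp
  time_prec : ∀ a b, ¬ Bp a b → ∃ c, ¬ Ct a c ∧ ¬ Bp cᶜ b
  prec_time : ∀ a b, ¬ Bp a b → ∃ c, ¬ Bp a c ∧ ¬ Ct cᶜ b

/-- A dynamic contact algebra. -/
structure DCA : Type (u + 1) where
  carrier : Type u
  [algebra : BooleanAlgebra carrier]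
  Cs : carrier → carrier → Prop
  Ct : carrier → carrier → Prop
  Bp : carrier → carrier → Prop
  isDCA : IsDCA Cs Ct Bp

attribute [instance] DCA.algebra

/-- A DCA-morphism: a Boolean homomorphism reflecting the three relations. -/
@[ext]
structure DCAHom (A A' : DCA.{u}) : Type u where
  toHom : BoundedLatticeHom A.carrier A'.carrier
  reflect_space : ∀ a b, A'.Cs (toHom a) (toHom b) → A.Cs a b
  reflect_time : ∀ a b, A'.Ct (toHom a) (toHom b) → A.Ct a b
  reflect_prec : ∀ a b, A'.Bp (toHom a) (toHom b) → A.Bp a b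

/-- The category of dynamic contact algebras. -/
instance : Category.{u} DCA.{u} where
  Hom A A' := DCAHom A A'
  id A := ⟨BoundedLatticeHom.id _, fun _ _ h => h, fun _ _ h => h, fun _ _ h => h⟩
  comp f g := ⟨g.toHom.comp f.toHom,
    fun _ _ h => f.reflect_space _ _ (g.reflect_space _ _ h),
    fun _ _ h => f.reflect_time _ _ (g.reflect_time _ _ h),
    fun _ _ h => f.reflect_prec _ _ (g.reflect_prec _ _ h)⟩

end DCA

/-! ### Time axioms and time conditions -/

section Time

/-- Names of the ten time axioms (and of the ten corresponding time conditions). -/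
inductive TimeAxiom : Type
  | rs | ls | upDir | downDir | circ | dens | ref | lin | tri | tr

/-- The time axiom with the given name, as a property of a Boolean algebra with time contact
`Ct` and precedence `Bp`. -/
def TimeAxiom.AlgHolds {B : Type u} [BooleanAlgebra B] (Ct Bp : B → B → Prop) :
    TimeAxiom → Prop
  | .rs => ∀ a, a ≠ ⊥ → Bp a ⊤
  | .ls => ∀ a, a ≠ ⊥ → Bp ⊤ a
  | .upDir => ∀ a b p, a ≠ ⊥ → b ≠ ⊥ → Bp a p ∨ Bp b pᶜ
  | .downDir => ∀ a b p, a ≠ ⊥ → b ≠ ⊥ → Bp p a ∨ Bp pᶜ b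
  | .circ => ∀ a b p, Bp a b → Bp b p ∨ Bp pᶜ a
  | .dens => ∀ a b p, Bp a b → Bp a p ∨ Bp pᶜ b
  | .ref => ∀ a b, Ct a b → Bp a b
  | .lin => ∀ a b, a ≠ ⊥ → b ≠ ⊥ → Bp a b ∨ Bp b a
  | .tri => ∀ a b, a ≠ ⊥ → b ≠ ⊥ → Ct a b ∨ Bp a b ∨ Bp b a
  | .tr => ∀ a b, ¬ Bp a b → ∃ c, ¬ Bp a c ∧ ¬ Bp cᶜ b

/-- The time condition with the given name, as a property of a time structure `(T, ≺)`. -/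
def TimeAxiom.TimeHolds {T : Type u} (prec : T → T → Prop) : TimeAxiom → Prop
  | .rs => ∀ m, ∃ n, prec m n
  | .ls => ∀ m, ∃ n, prec n m
  | .upDir => ∀ i j, ∃ k, prec i k ∧ prec j k
  | .downDir => ∀ i j, ∃ k, prec k i ∧ prec k j
  | .circ => ∀ i j, prec i j → ∃ k, prec j k ∧ prec k i
  | .dens => ∀ i j, prec i j → ∃ k, prec i k ∧ prec k j
  | .ref => ∀ m, prec m m
  | .lin => ∀ m n, prec m n ∨ prec n m
  | .tri => ∀ m n, m = n ∨ prec m n ∨ prec n m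
  | .tr => ∀ i j k, prec i j → prec j k → prec i k

end Time

/-! ### The Boolean algebra of regular closed sets -/

section RegClosed

/-- The regular closed subsets of a topological space. -/
def RegClosed (X : Type u) [TopologicalSpace X] : Type u :=
  {s : Set X // closure (interior s) = s}

variable {X : Type u} [TopologicalSpace X]

/-- The underlying set of a regular closed set. -/
def RegClosed.set (a : RegClosed X) : Set X := a.1

theorem RegClosed.ext_set {a b : RegClosed X} (h : a.set = b.set) : a = b := Subtype.ext h

theorem RegClosed.regular (a : RegClosed X) : closure (interior a.set) = a.set := a.2

theorem RegClosed.isClosed (a : RegClosed X) : IsClosed a.set := by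
  rw [← a.regular]; exact isClosed_closure

theorem regular_closure_of_isOpen {U : Set X} (hU : IsOpen U) :
    closure (interior (closure U)) = closure U :=
  subset_antisymm (closure_minimal interior_subset isClosed_closure)
    (closure_mono (interior_maximal subset_closure hU))

/-- The regular closed sets form a Boolean algebra: the order is inclusion, `a + b = a ∪ b`,
`a . b = Cl Int (a ∩ b)`, `a* = Cl (X \ a)`, `0 = ∅`, `1 = X`. -/
instance : BooleanAlgebra (RegClosed X) where
  le a b := a.set ⊆ b.set
  le_refl _ := subset_rfl
  le_trans _ _ _ h h' := Set.Subset.trans h h'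
  le_antisymm _ _ h h' := RegClosed.ext_set (Set.Subset.antisymm h h')
  sup a b := ⟨a.set ∪ b.set, subset_antisymm
    (closure_minimal interior_subset (a.isClosed.union b.isClosed))
    (Set.union_subset
      (a.regular.symm.subset.trans (closure_mono (interior_mono Set.subset_union_left)))
      (b.regular.symm.subset.trans (closure_mono (interior_mono Set.subset_union_right))))⟩
  le_sup_left _ _ := Set.subset_union_left
  le_sup_right _ _ := Set.subset_union_right
  sup_le _ _ _ h h' := Set.union_subset h h'
  inf a b := ⟨closure (interior (a.set ∩ b.set)), regular_closure_of_isOpen isOpen_interior⟩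
  inf_le_left a b :=
    (closure_mono (interior_mono Set.inter_subset_left)).trans a.regular.subset
  inf_le_right a b :=
    (closure_mono (interior_mono Set.inter_subset_right)).trans b.regular.subset
  le_inf a b c h h' :=
    a.regular.symm.subset.trans (closure_mono (interior_mono (Set.subset_inter h h')))
  le_sup_inf a b c := by
    change closure (interior ((a.set ∪ b.set) ∩ (a.set ∪ c.set))) ⊆
      a.set ∪ closure (interior (b.set ∩ c.set))
    refine closure_minimal (fun x hx => ?_) (a.isClosed.union isClosed_closure)
    by_cases hxa : x ∈ a.set
    · exact Or.inl hxa
    · refine Or.inr (subset_closure (mem_interior.2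
        ⟨interior ((a.set ∪ b.set) ∩ (a.set ∪ c.set)) ∩ a.setᶜ, ?_,
          isOpen_interior.inter a.isClosed.isOpen_compl, hx, hxa⟩))
      rintro y ⟨hy, hya⟩
      obtain ⟨h1, h2⟩ := interior_subset hy
      exact ⟨h1.resolve_left hya, h2.resolve_left hya⟩
  compl a := ⟨closure a.setᶜ, regular_closure_of_isOpen a.isClosed.isOpen_compl⟩
  top := ⟨Set.univ, by simp⟩
  bot := ⟨∅, by simp⟩
  le_top _ := Set.subset_univ _
  bot_le _ := Set.empty_subset _
  inf_compl_le_bot a := by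
    change closure (interior (a.set ∩ closure a.setᶜ)) ⊆ ∅
    rw [closure_compl, interior_inter]
    have h : interior a.set ∩ interior (interior a.set)ᶜ = ∅ := Set.subset_empty_iff.1
      fun x hx => interior_subset hx.2 hx.1
    rw [h, closure_empty]
  top_le_sup_compl a := by
    change Set.univ ⊆ a.set ∪ closure a.setᶜ
    intro x _
    by_cases hx : x ∈ a.set
    · exact Or.inl hx
    · exact Or.inr (subset_closure hx)

/-- Time contact of regular closed sets. -/
def timeContact (a b : RegClosed X) : Prop := (a.set ∩ b.set).Nonempty

/-- Space contact of regular closed sets, `Xs` being the set of space points. -/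
def spaceContact (Xs : Set X) (a b : RegClosed X) : Prop := (a.set ∩ b.set ∩ Xs).Nonempty

/-- Precedence of regular closed sets, `prec` being the before-after relation. -/
def precedence (prec : X → X → Prop) (a b : RegClosed X) : Prop :=
  ∃ x y, prec x y ∧ x ∈ a.set ∧ y ∈ b.set

end RegClosed

/-! ### Dynamic mereotopological spaces -/

section DMS

/-- A dynamic mereotopological space. -/
structure DMS : Type (u + 1) where
  /-- partial time points -/
  Xt : Type u
  [top : TopologicalSpace Xt]
  [nonempty : Nonempty Xt]
  /-- space points -/
  Xs : Set Xt
  /-- time points -/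
  T : Set Xt
  /-- the before-after relation -/
  prec : Xt → Xt → Prop
  M : BooleanSubalgebra (RegClosed Xt)
  /-- `M` is a closed base of the topology: the complements of its members form a base -/
  closed_base : TopologicalSpace.IsTopologicalBasis {U : Set Xt | ∃ a ∈ M, U = a.setᶜ}
  Xs_nonempty : Xs.Nonempty
  T_nonempty : T.Nonempty
  inter_Xs : ∀ a : RegClosed Xt, a.set.Nonempty → (a.set ∩ Xs).Nonempty
  /-- the dual algebra of the space is a dynamic contact algebra -/
  isDCA : IsDCA (B := M) (fun a b => spaceContact Xs a.1 b.1) (fun a b => timeContact a.1 b.1)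
    (fun a b => precedence prec a.1 b.1)
  prec_iff : ∀ x y, prec x y ↔
    ∀ a b : M, x ∈ a.1.set → y ∈ b.1.set → precedence prec a.1 b.1
  cluster_of_mem_T : ∀ x ∈ T,
    IsCluster (B := M) (fun a b => timeContact a.1 b.1) {a | x ∈ a.1.set}

attribute [instance] DMS.top DMS.nonempty

/-- The dual DCA of a DMS. -/
def DMS.dual (S : DMS.{u}) : DCA.{u} where
  carrier := S.M
  Cs a b := spaceContact S.Xs a.1 b.1
  Ct a b := timeContact a.1 b.1
  Bp a b := precedence S.prec a.1 b.1
  isDCA := S.isDCA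

/-- The members of `M` containing the point `x`, as a subset of the dual algebra. -/
def DMS.rho (S : DMS.{u}) (x : S.Xt) : Set S.dual.carrier := {a : S.M | x ∈ a.1.set}

/-- A DMS-morphism. The last field says that taking preimages maps the members of `S'.M` to
members of `S.M`, and is as such a homomorphism of Boolean algebras. -/
@[ext]
structure DMSHom (S S' : DMS.{u}) : Type u where
  toFun : S.Xt → S'.Xt
  map_Xs : ∀ x ∈ S.Xs, toFun x ∈ S'.Xs
  map_prec : ∀ x y, S.prec x y → S'.prec (toFun x) (toFun y)
  preimage_hom : ∃ h : BoundedLatticeHom S'.M S.M, ∀ a : S'.M,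
    (h a).1.set = toFun ⁻¹' a.1.set

/-- The category of dynamic mereotopological spaces. -/
instance : Category.{u} DMS.{u} where
  Hom S S' := DMSHom S S'
  id S := ⟨id, fun _ h => h, fun _ _ h => h, BoundedLatticeHom.id _, fun _ => rfl⟩
  comp f g := ⟨g.toFun ∘ f.toFun, fun x hx => g.map_Xs _ (f.map_Xs x hx),
    fun x y h => g.map_prec _ _ (f.map_prec x y h), by
      obtain ⟨h, hh⟩ := f.preimage_hom
      obtain ⟨k, hk⟩ := g.preimage_hom
      exact ⟨h.comp k, fun a => by
        rw [BoundedLatticeHom.comp_apply, hh, hk, Set.preimage_comp]⟩⟩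

/-- DM-compactness: every t-clan, s-clan and cluster of the dual algebra is the set `rho x` of
a point, a space point and a time point `x`, respectively. -/
structure DMS.IsDMCompact (S : DMS.{u}) : Prop where
  t_clan : ∀ Γ, IsClan S.dual.Ct Γ → ∃ x, Γ = S.rho x
  s_clan : ∀ Γ, IsClan S.dual.Cs Γ → ∃ x ∈ S.Xs, Γ = S.rho x
  cluster : ∀ Γ, IsCluster S.dual.Ct Γ → ∃ x ∈ S.T, Γ = S.rho x

end DMS

/-! ### The full subcategories -/

section Subcategories

/-- The DCAs that satisfy all the time axioms in `Ax`. -/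
def DCASat (Ax : Set TimeAxiom) : ObjectProperty DCA.{u} :=
  fun A => ∀ φ ∈ Ax, φ.AlgHolds A.Ct A.Bp

/-- The T0, DM-compact DMSes whose time structure satisfies the time conditions corresponding
to the time axioms in `Ax`. -/
def DMSSat (Ax : Set TimeAxiom) : ObjectProperty DMS.{u} :=
  fun S => T0Space S.Xt ∧ S.IsDMCompact ∧
    ∀ φ ∈ Ax, φ.TimeHolds (fun i j : S.T => S.prec i j)

end Subcategories

end DynMereo

/-! The contravariant functor S ↦ S⁺ from T0, DM-compact spaces to algebras, acting on maps by
preimage, is full, faithful and essentially surjective. A point x of a space is a t-clan `rho x` of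
the dual algebra. T0 makes this assignment injective, since `M` is a closed base; DM-compactness
makes it onto the t-clans, and identifies space points with s-clans and time points with clusters. A
morphism of dual algebras pulls clans back to clans, because it reflects contact, so it comes from
exactly one map of points (`DMSHom.dual_injective`, `DMSHom.dual_surjective`). For essential
surjectivity, the t-clans of A are topologized with the sets `stone a` as closed base. These sets
are regular closed and form a copy of A; the three relations are recovered because related elements
lie in related ultrafilters, and two ultrafilters in contact have a clan as union. The time axioms
transfer because each is equivalent to its time condition on the clusters of the algebra. Every
cluster is the set of elements in time contact with all of some ultrafilter, and precedence of such
clusters reduces to precedence of the ultrafilters (`IsDCA.related_contactSet_iff`). The time points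
required by the conditions then come from `IsGrill.exists_ultra_inter`. -/

namespace DynMereo

/-! ### Grills and ultrafilters of a Boolean algebra -/

section Grills

variable {B : Type u} [BooleanAlgebra B]

/-- Grills: prime upper sets that do not contain `⊥`. -/
structure IsGrill (G : Set B) : Prop where
  bot_notMem : ⊥ ∉ G
  up : ∀ a b, a ∈ G → a ≤ b → b ∈ G
  prime : ∀ a b, a ⊔ b ∈ G → a ∈ G ∨ b ∈ G

/-- Ultrafilters of a Boolean algebra: grills closed under meets and containing `⊤`. -/
structure IsUltra (U : Set B) : Prop extends IsGrill U where
  top_mem : ⊤ ∈ U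
  inf_mem : ∀ a b, a ∈ U → b ∈ U → a ⊓ b ∈ U

theorem IsClan.isGrill {C : B → B → Prop} {Γ : Set B} (h : IsClan C Γ) : IsGrill Γ :=
  ⟨h.bot_notMem, h.up, h.prime⟩

theorem IsUltra.mem_or_compl_mem {U : Set B} (hU : IsUltra U) (a : B) : a ∈ U ∨ aᶜ ∈ U :=
  hU.prime _ _ (by rw [sup_compl_eq_top]; exact hU.top_mem)

/-- The complement of a grill is an ideal, disjoint from the principal filter of `a`. The prime
ideal theorem separates the two, and the complement of the prime ideal is the ultrafilter. -/
theorem IsGrill.exists_ultra {G : Set B} (hG : IsGrill G) {a : B} (ha : a ∈ G) :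
    ∃ U, IsUltra U ∧ a ∈ U ∧ U ⊆ G := by
  let I : Order.Ideal B :=
    { carrier := Gᶜ
      lower' := fun x y hyx hx hy => hx (hG.up _ _ hy hyx)
      nonempty' := ⟨⊥, hG.bot_notMem⟩
      directed' := fun x hx y hy =>
        ⟨x ⊔ y, fun h => (hG.prime _ _ h).elim hx hy, le_sup_left, le_sup_right⟩ }
  have hd : Disjoint (Order.PFilter.principal a : Set B) (I : Set B) := by
    rw [Set.disjoint_left]
    intro x hx hxI
    exact hxI (hG.up _ _ ha (Order.PFilter.mem_principal.1 hx))
  obtain ⟨J, hJ, hIJ, hdJ⟩ := DistribLattice.prime_ideal_of_disjoint_filter_ideal hd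
  refine ⟨(J : Set B)ᶜ, ⟨⟨?_, ?_, ?_⟩, ?_, ?_⟩, ?_, ?_⟩
  · exact fun h => h J.bot_mem
  · exact fun x y hx hxy hy => hx (J.lower hxy hy)
  · intro x y hxy
    by_contra! h
    exact hxy (Order.Ideal.sup_mem (not_not.1 h.1) (not_not.1 h.2))
  · intro h
    exact hJ.toIsProper.ne_univ (Set.eq_univ_of_forall fun x => J.lower le_top h)
  · intro x y hx hy h
    exact (hJ.mem_or_mem h).elim hx hy
  · exact fun h => Set.disjoint_left.1 hdJ (Order.PFilter.mem_principal.2 le_rfl) h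
  · intro x hx
    by_contra hxG
    exact hx (hIJ hxG)

theorem exists_ultra_of_ne_bot {a : B} (ha : a ≠ ⊥) : ∃ U, IsUltra U ∧ a ∈ U := by
  have hG : IsGrill {x : B | x ≠ ⊥} :=
    ⟨fun h => h rfl, fun x y hx hxy hy => hx (le_bot_iff.1 (hy ▸ hxy)), fun x y hxy => by
      by_contra! h
      exact hxy (by rw [not_not.1 h.1, not_not.1 h.2, sup_bot_eq])⟩
  obtain ⟨U, hU, haU, -⟩ := hG.exists_ultra ha
  exact ⟨U, hU, haU⟩

theorem IsUltra.ne_bot {U : Set B} (hU : IsUltra U) {a : B} (ha : a ∈ U) : a ≠ ⊥ :=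
  fun h => hU.bot_notMem (h ▸ ha)

/-- Two grills such that one contains every element or the other its complement have a common
ultrafilter. -/
theorem IsGrill.exists_ultra_inter {G H : Set B} (hG : IsGrill G) (hH : IsGrill H)
    (h : ∀ c, c ∈ G ∨ cᶜ ∈ H) : ∃ U, IsUltra U ∧ U ⊆ G ∧ U ⊆ H := by
  -- The complement of `K` is the ideal generated by the ideals `Gᶜ` and `Hᶜ`. The hypothesis says
  -- exactly that this ideal is proper, so an ultrafilter inside `K` avoids both ideals.
  let K : Set B := {x | ∀ c d, x ≤ c ⊔ d → c ∈ G ∨ d ∈ H}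
  have hK : IsGrill K := by
    refine ⟨fun hb => ?_, fun x y hx hxy c d hy => hx c d (hxy.trans hy), fun x y hxy => ?_⟩
    · exact (hb ⊥ ⊥ bot_le).elim hG.bot_notMem hH.bot_notMem
    · by_contra! hn
      simp only [K, Set.mem_ofPred_eq, not_forall, not_or] at hn
      obtain ⟨⟨c, d, hx, hc, hd⟩, ⟨c', d', hy, hc', hd'⟩⟩ := hn
      have hle : x ⊔ y ≤ (c ⊔ c') ⊔ (d ⊔ d') := by
        rw [sup_sup_sup_comm]; exact sup_le_sup hx hy
      rcases hxy _ _ hle with h1 | h1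
      · exact (hG.prime _ _ h1).elim hc hc'
      · exact (hH.prime _ _ h1).elim hd hd'
  have htop : ⊤ ∈ K := fun c d hcd => (h c).imp_right fun hc =>
    hH.up _ _ hc (codisjoint_iff_compl_le_right.1 (codisjoint_iff_le_sup.2 hcd))
  obtain ⟨U, hU, -, hUK⟩ := hK.exists_ultra htop
  refine ⟨U, hU, fun x hx => ?_, fun x hx => ?_⟩
  · exact (hUK hx x ⊥ le_sup_left).resolve_right hH.bot_notMem
  · exact (hUK hx ⊥ x le_sup_right).resolve_left hG.bot_notMem

end Grills

/-! ### Precontact relations and ultrafilters -/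

section Related

variable {B : Type u} [BooleanAlgebra B] {R : B → B → Prop}

/-- The canonical extension of a relation to sets. -/
def Related (R : B → B → Prop) (U V : Set B) : Prop := ∀ a ∈ U, ∀ b ∈ V, R a b

theorem IsPrecontact.flip (hR : IsPrecontact R) : IsPrecontact (flip R) :=
  ⟨fun _ _ h => (hR.ne_bot _ _ h).symm, fun _ _ _ _ h h1 h2 => hR.mono _ _ _ _ h h2 h1,
    fun _ _ _ h => hR.sup_left _ _ _ h, fun _ _ _ h => hR.sup_right _ _ _ h⟩

/-- Closure of `U` under meets gives primality: if `a` and `a'` witness that `x` and `y` fail, then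
`a ⊓ a'` is related to neither. -/
theorem IsPrecontact.isGrill_image (hR : IsPrecontact R) {U : Set B} (hU : IsUltra U) :
    IsGrill {b | ∀ a ∈ U, R a b} := by
  refine ⟨fun h => (hR.ne_bot _ _ (h ⊤ hU.top_mem)).2 rfl,
    fun x y hx hxy a ha => hR.mono _ _ _ _ (hx a ha) le_rfl hxy, fun x y hxy => ?_⟩
  by_contra! hn
  simp only [Set.mem_ofPred_eq, not_forall] at hn
  obtain ⟨⟨a, ha, hax⟩, ⟨a', ha', hay⟩⟩ := hn
  rcases hR.sup_right _ _ _ (hxy _ (hU.inf_mem _ _ ha ha')) with h | h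
  · exact hax (hR.mono _ _ _ _ h inf_le_left le_rfl)
  · exact hay (hR.mono _ _ _ _ h inf_le_right le_rfl)

theorem IsPrecontact.isGrill_preimage (hR : IsPrecontact R) {U : Set B} (hU : IsUltra U) :
    IsGrill {b | ∀ a ∈ U, R b a} := hR.flip.isGrill_image hU

theorem IsPrecontact.isGrill_right (hR : IsPrecontact R) (a : B) : IsGrill {b | R a b} :=
  ⟨fun h => (hR.ne_bot _ _ h).2 rfl, fun _ _ hx hxy => hR.mono _ _ _ _ hx le_rfl hxy,
    fun _ _ h => hR.sup_right _ _ _ h⟩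

theorem IsPrecontact.isGrill_left (hR : IsPrecontact R) (a : B) : IsGrill {b | R b a} :=
  hR.flip.isGrill_right a

theorem IsPrecontact.exists_right (hR : IsPrecontact R) {U : Set B} (hU : IsUltra U) {b : B}
    (hb : ∀ a ∈ U, R a b) : ∃ V, IsUltra V ∧ b ∈ V ∧ Related R U V := by
  obtain ⟨V, hV, hbV, h⟩ := (hR.isGrill_image hU).exists_ultra hb
  exact ⟨V, hV, hbV, fun a ha b hb => h hb a ha⟩

theorem IsPrecontact.exists_left (hR : IsPrecontact R) {V : Set B} (hV : IsUltra V) {a : B}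
    (ha : ∀ b ∈ V, R a b) : ∃ U, IsUltra U ∧ a ∈ U ∧ Related R U V := by
  obtain ⟨U, hU, haU, h⟩ := (hR.isGrill_preimage hV).exists_ultra ha
  exact ⟨U, hU, haU, fun a ha b hb => h ha b hb⟩

/-- Related elements lie in related ultrafilters. -/
theorem IsPrecontact.exists_ultra (hR : IsPrecontact R) {a b : B} (h : R a b) :
    ∃ U V, IsUltra U ∧ IsUltra V ∧ a ∈ U ∧ b ∈ V ∧ Related R U V := by
  obtain ⟨U, hU, haU, hUb⟩ := (hR.isGrill_left b).exists_ultra h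
  obtain ⟨V, hV, hbV, hUV⟩ := hR.exists_right hU hUb
  exact ⟨U, V, hU, hV, haU, hbV, hUV⟩

end Related

/-! ### Clans and clusters from ultrafilters -/

section ClanExistence

variable {B : Type u} [BooleanAlgebra B] {C : B → B → Prop}

theorem IsContact.of_mem_ultra (hC : IsContact C) {U : Set B} (hU : IsUltra U) {a b : B}
    (ha : a ∈ U) (hb : b ∈ U) : C a b :=
  hC.overlap _ _ (hU.ne_bot (hU.inf_mem _ _ ha hb))

theorem IsContact.isClan_of_isUltra (hC : IsContact C) {U : Set B} (hU : IsUltra U) :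
    IsClan C U :=
  ⟨hU.top_mem, hU.bot_notMem, hU.up, hU.prime, fun _ _ ha hb => hC.of_mem_ultra hU ha hb⟩

/-- A union of grills is a grill. Contact inside each ultrafilter is overlap; contact across them is
the relatedness assumption. -/
theorem IsContact.isClan_union (hC : IsContact C) {U V : Set B} (hU : IsUltra U)
    (hV : IsUltra V) (h : Related C U V) : IsClan C (U ∪ V) where
  top_mem := Or.inl hU.top_mem
  bot_notMem h := h.elim hU.bot_notMem hV.bot_notMem
  up a b ha hab := ha.imp (fun h => hU.up _ _ h hab) (fun h => hV.up _ _ h hab)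
  prime a b hab := hab.elim
    (fun h => (hU.prime _ _ h).imp Or.inl Or.inl)
    (fun h => (hV.prime _ _ h).imp Or.inr Or.inr)
  contact a b ha hb := by
    rcases ha with ha | ha <;> rcases hb with hb | hb
    · exact hC.of_mem_ultra hU ha hb
    · exact h _ ha _ hb
    · exact hC.symm _ _ (h _ hb _ ha)
    · exact hC.of_mem_ultra hV ha hb

/-- Elements in contact lie in a common clan. -/
theorem IsContact.exists_clan (hC : IsContact C) {a b : B} (h : C a b) :
    ∃ Γ, IsClan C Γ ∧ a ∈ Γ ∧ b ∈ Γ := by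
  obtain ⟨U, V, hU, hV, ha, hb, hUV⟩ := hC.toIsPrecontact.exists_ultra h
  exact ⟨U ∪ V, hC.isClan_union hU hV hUV, Or.inl ha, Or.inr hb⟩

theorem IsClan.of_le {C' : B → B → Prop} {Γ : Set B} (h : IsClan C Γ)
    (hle : ∀ a b, C a b → C' a b) : IsClan C' Γ :=
  { h with contact := fun a b ha hb => hle _ _ (h.contact a b ha hb) }

/-- The elements in contact with all members of `U`. -/
def contactSet (C : B → B → Prop) (U : Set B) : Set B := {a | ∀ b ∈ U, C a b}

end ClanExistence

namespace IsDCA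

variable {B : Type u} [BooleanAlgebra B] {Cs Ct Bp : B → B → Prop} (h : IsDCA Cs Ct Bp)
include h

theorem subset_contactSet {U : Set B} (hU : IsUltra U) : U ⊆ contactSet Ct U :=
  fun _ ha _ hb => h.contact_time.of_mem_ultra hU ha hb

/-- The Efremovich axiom makes this set a clan: if `a` and `b` were apart, a separating `c` or its
complement would lie in `U`, contradicting contact of `U` with `a` or with `b`. The cluster
condition is immediate, as the member of `U` apart from `a` is itself in the set. -/
theorem isCluster_contactSet {U : Set B} (hU : IsUltra U) :
    IsCluster Ct (contactSet Ct U) := by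
  have hG := h.contact_time.toIsPrecontact.isGrill_preimage hU
  refine ⟨⟨h.subset_contactSet hU hU.top_mem, hG.bot_notMem, hG.up, hG.prime, ?_⟩, ?_⟩
  · intro a b ha hb
    by_contra hab
    obtain ⟨c, hac, hcb⟩ := h.efremovich _ _ hab
    rcases hU.mem_or_compl_mem c with hc | hc
    · exact hac (ha _ hc)
    · exact hcb (h.contact_time.symm _ _ (hb _ hc))
  · intro a ha
    simp only [contactSet, Set.mem_ofPred_eq, not_forall] at ha
    obtain ⟨b, hb, hab⟩ := ha
    exact ⟨b, h.subset_contactSet hU hb, hab⟩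

/-- Any ultrafilter inside the cluster works: the clan property gives one inclusion. For the other,
an element outside the cluster is apart from some member of it, which cannot happen inside the clan
`contactSet Ct U`. -/
theorem exists_eq_contactSet {Γ : Set B} (hΓ : IsCluster Ct Γ) {a : B} (ha : a ∈ Γ) :
    ∃ U, IsUltra U ∧ a ∈ U ∧ Γ = contactSet Ct U := by
  obtain ⟨U, hU, haU, hUΓ⟩ := hΓ.toIsClan.isGrill.exists_ultra ha
  have hsub : Γ ⊆ contactSet Ct U := fun a ha b hb => hΓ.contact _ _ ha (hUΓ hb)
  refine ⟨U, hU, haU, hsub.antisymm fun a ha => ?_⟩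
  by_contra hn
  obtain ⟨b, hb, hab⟩ := hΓ.cluster a hn
  exact hab ((h.isCluster_contactSet hU).contact _ _ ha (hsub hb))

theorem exists_cluster_of_contact {a b : B} (hab : Ct a b) :
    ∃ Γ, IsCluster Ct Γ ∧ a ∈ Γ ∧ b ∈ Γ := by
  obtain ⟨Γ, hΓ, ha, hb⟩ := h.contact_time.exists_clan hab
  obtain ⟨U, hU, -, hUΓ⟩ := hΓ.isGrill.exists_ultra ha
  exact ⟨_, h.isCluster_contactSet hU, fun c hc => hΓ.contact _ _ ha (hUΓ hc),
    fun c hc => hΓ.contact _ _ hb (hUΓ hc)⟩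

/-- The two axioms mixing precedence with time contact move a failure of precedence from the
clusters into the ultrafilters: `time_prec` replaces the left element by a member of `U`, then
`prec_time` the right one by a member of `V`. -/
theorem related_contactSet_iff {U V : Set B} (hU : IsUltra U) (hV : IsUltra V) :
    Related Bp (contactSet Ct U) (contactSet Ct V) ↔ Related Bp U V := by
  refine ⟨fun hR a ha b hb => hR _ (h.subset_contactSet hU ha) _ (h.subset_contactSet hV hb),
    fun hR a ha b hb => ?_⟩
  by_contra hab
  obtain ⟨c, hac, hcb⟩ := h.time_prec _ _ hab
  have hc := (hU.mem_or_compl_mem c).resolve_left fun hc => hac (ha _ hc)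
  obtain ⟨d, hcd, hdb⟩ := h.prec_time _ _ hcb
  have hd := (hV.mem_or_compl_mem d).resolve_right fun hd =>
    hdb (h.contact_time.symm _ _ (hb _ hd))
  exact hcd (hR _ hc _ hd)

/-- Ultrafilters in time contact determine the same time point; this supplies the equality
alternative in the trichotomy condition. -/
theorem contactSet_eq {U V : Set B} (hU : IsUltra U) (hV : IsUltra V) (hUV : Related Ct U V) :
    contactSet Ct U = contactSet Ct V := by
  have key : ∀ {U V : Set B}, IsUltra U → Related Ct U V →
      contactSet Ct U ⊆ contactSet Ct V := by
    intro U V hU hUV a ha b hb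
    by_contra hab
    obtain ⟨c, hac, hcb⟩ := h.efremovich _ _ hab
    rcases hU.mem_or_compl_mem c with hc | hc
    · exact hac (ha _ hc)
    · exact hcb (hUV _ hc _ hb)
  exact (key hU hUV).antisymm
    (key hV fun a ha b hb => h.contact_time.symm _ _ (hUV _ hb _ ha))

end IsDCA

/-! ### Time axioms and the time structure of clusters -/

section Correspondence

variable {B : Type u} [BooleanAlgebra B] {Cs Ct Bp : B → B → Prop}

/-- Quantification over clusters is quantification over the clusters of ultrafilters. -/
theorem IsDCA.forall_cluster (h : IsDCA Cs Ct Bp) {P : {Γ : Set B // IsCluster Ct Γ} → Prop}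
    (hP : ∀ U, ∀ hU : IsUltra U, P ⟨contactSet Ct U, h.isCluster_contactSet hU⟩) : ∀ Γ, P Γ := by
  rintro ⟨Γ, hΓ⟩
  obtain ⟨U, hU, -, rfl⟩ := h.exists_eq_contactSet hΓ hΓ.top_mem
  exact hP U hU

/-- Existential conditions need an ultrafilter inside one grill (`rs`, `ls`) or inside two, where
the arbitrary element `p` of the axiom is the splitting element in `IsGrill.exists_ultra_inter`. The
disjunctive conditions `lin` and `tri` are proved by contradiction, meeting the witnesses of all
failures within each ultrafilter. -/
theorem IsDCA.timeHolds_of_algHolds (h : IsDCA Cs Ct Bp) {φ : TimeAxiom}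
    (hφ : φ.AlgHolds Ct Bp) :
    φ.TimeHolds (fun Γ Δ : {Γ : Set B // IsCluster Ct Γ} => Related Bp Γ.1 Δ.1) := by
  have hB := h.precontact
  cases φ <;> simp only [TimeAxiom.AlgHolds] at hφ <;> simp only [TimeAxiom.TimeHolds]
  case rs =>
    refine h.forall_cluster fun U hU => ?_
    obtain ⟨V, hV, -, hUV⟩ := hB.exists_right hU fun a ha => hφ a (hU.ne_bot ha)
    exact ⟨⟨_, h.isCluster_contactSet hV⟩, (h.related_contactSet_iff hU hV).2 hUV⟩
  case ls =>
    refine h.forall_cluster fun U hU => ?_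
    obtain ⟨V, hV, -, hUV⟩ := hB.exists_left hU fun a ha => hφ a (hU.ne_bot ha)
    exact ⟨⟨_, h.isCluster_contactSet hV⟩, (h.related_contactSet_iff hV hU).2 hUV⟩
  case upDir =>
    refine h.forall_cluster fun U hU => h.forall_cluster fun V hV => ?_
    obtain ⟨W, hW, h1, h2⟩ :=
      (hB.isGrill_image hU).exists_ultra_inter (hB.isGrill_image hV) fun c => by
        by_contra! hn
        simp only [Set.mem_ofPred_eq, not_forall] at hn
        obtain ⟨⟨a, ha, hac⟩, ⟨b, hb, hbc⟩⟩ := hn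
        exact (hφ a b c (hU.ne_bot ha) (hV.ne_bot hb)).elim hac hbc
    exact ⟨⟨_, h.isCluster_contactSet hW⟩,
      (h.related_contactSet_iff hU hW).2 fun a ha b hb => h1 hb a ha,
      (h.related_contactSet_iff hV hW).2 fun a ha b hb => h2 hb a ha⟩
  case downDir =>
    refine h.forall_cluster fun U hU => h.forall_cluster fun V hV => ?_
    obtain ⟨W, hW, h1, h2⟩ :=
      (hB.isGrill_preimage hU).exists_ultra_inter (hB.isGrill_preimage hV) fun c => by
        by_contra! hn
        simp only [Set.mem_ofPred_eq, not_forall] at hn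
        obtain ⟨⟨a, ha, hac⟩, ⟨b, hb, hbc⟩⟩ := hn
        exact (hφ a b c (hU.ne_bot ha) (hV.ne_bot hb)).elim hac hbc
    exact ⟨⟨_, h.isCluster_contactSet hW⟩,
      (h.related_contactSet_iff hW hU).2 fun a ha b hb => h1 ha b hb,
      (h.related_contactSet_iff hW hV).2 fun a ha b hb => h2 ha b hb⟩
  case circ =>
    refine h.forall_cluster fun U hU => h.forall_cluster fun V hV hUV => ?_
    rw [h.related_contactSet_iff hU hV] at hUV
    obtain ⟨W, hW, h1, h2⟩ :=
      (hB.isGrill_image hV).exists_ultra_inter (hB.isGrill_preimage hU) fun c => by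
        by_contra! hn
        simp only [Set.mem_ofPred_eq, not_forall] at hn
        obtain ⟨⟨b, hb, hbc⟩, ⟨a, ha, hac⟩⟩ := hn
        exact (hφ a b c (hUV a ha b hb)).elim hbc hac
    exact ⟨⟨_, h.isCluster_contactSet hW⟩,
      (h.related_contactSet_iff hV hW).2 fun a ha b hb => h1 hb a ha,
      (h.related_contactSet_iff hW hU).2 fun a ha b hb => h2 ha b hb⟩
  case dens =>
    refine h.forall_cluster fun U hU => h.forall_cluster fun V hV hUV => ?_
    rw [h.related_contactSet_iff hU hV] at hUV
    obtain ⟨W, hW, h1, h2⟩ :=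
      (hB.isGrill_image hU).exists_ultra_inter (hB.isGrill_preimage hV) fun c => by
        by_contra! hn
        simp only [Set.mem_ofPred_eq, not_forall] at hn
        obtain ⟨⟨a, ha, hac⟩, ⟨b, hb, hbc⟩⟩ := hn
        exact (hφ a b c (hUV a ha b hb)).elim hac hbc
    exact ⟨⟨_, h.isCluster_contactSet hW⟩,
      (h.related_contactSet_iff hU hW).2 fun a ha b hb => h1 hb a ha,
      (h.related_contactSet_iff hW hV).2 fun a ha b hb => h2 ha b hb⟩
  case ref => exact fun Γ a ha b hb => hφ a b (Γ.2.contact a b ha hb)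
  case lin =>
    refine h.forall_cluster fun U hU => h.forall_cluster fun V hV => ?_
    simp only [h.related_contactSet_iff hU hV, h.related_contactSet_iff hV hU]
    by_contra! hn
    simp only [Related, not_forall] at hn
    obtain ⟨⟨a, ha, b, hb, hab⟩, ⟨d, hd, c, hc, hdc⟩⟩ := hn
    rcases hφ _ _ (hU.ne_bot (hU.inf_mem _ _ ha hc)) (hV.ne_bot (hV.inf_mem _ _ hb hd)) with h1 | h1
    · exact hab (hB.mono _ _ _ _ h1 inf_le_left inf_le_left)
    · exact hdc (hB.mono _ _ _ _ h1 inf_le_right inf_le_right)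
  case tri =>
    refine h.forall_cluster fun U hU => h.forall_cluster fun V hV => ?_
    simp only [h.related_contactSet_iff hU hV, h.related_contactSet_iff hV hU]
    by_contra! hn
    obtain ⟨hne, hn⟩ := hn
    have hne' : ¬ Related Ct U V := fun hUV => hne (Subtype.ext (h.contactSet_eq hU hV hUV))
    simp only [Related, not_forall] at hn hne'
    obtain ⟨⟨a, ha, b, hb, hab⟩, ⟨d, hd, c, hc, hdc⟩⟩ := hn
    obtain ⟨x, hx, y, hy, hxy⟩ := hne'
    rcases hφ _ _ (hU.ne_bot (hU.inf_mem _ _ hx (hU.inf_mem _ _ ha hc)))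
      (hV.ne_bot (hV.inf_mem _ _ hy (hV.inf_mem _ _ hb hd))) with h1 | h1 | h1
    · exact hxy (h.contact_time.mono _ _ _ _ h1 inf_le_left inf_le_left)
    · exact hab (hB.mono _ _ _ _ h1 (inf_le_right.trans inf_le_left)
        (inf_le_right.trans inf_le_left))
    · exact hdc (hB.mono _ _ _ _ h1 (inf_le_right.trans inf_le_right)
        (inf_le_right.trans inf_le_right))
  case tr =>
    intro Γ Δ Λ h1 h2 a ha b hb
    by_contra hab
    obtain ⟨c, hac, hcb⟩ := hφ a b hab
    -- The middle cluster contains `c` or its complement, and either contradicts one of the two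
    -- precedences.
    have hc : c ⊔ cᶜ ∈ Δ.1 := by rw [sup_compl_eq_top]; exact Δ.2.top_mem
    rcases Δ.2.prime _ _ hc with hc | hc
    · exact hac (h1 _ ha _ hc)
    · exact hcb (h2 _ hc _ hb)

theorem IsDCA.exists_cluster_of_ne_bot (h : IsDCA Cs Ct Bp) {a : B} (ha : a ≠ ⊥) :
    ∃ Γ : {Γ : Set B // IsCluster Ct Γ}, a ∈ Γ.1 := by
  obtain ⟨U, hU, haU⟩ := exists_ultra_of_ne_bot ha
  exact ⟨⟨_, h.isCluster_contactSet hU⟩, h.subset_contactSet hU haU⟩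

theorem IsDCA.exists_cluster_of_prec (h : IsDCA Cs Ct Bp) {a b : B} (hab : Bp a b) :
    ∃ Γ Δ : {Γ : Set B // IsCluster Ct Γ}, a ∈ Γ.1 ∧ b ∈ Δ.1 ∧ Related Bp Γ.1 Δ.1 := by
  obtain ⟨U, V, hU, hV, haU, hbV, hUV⟩ := h.precontact.exists_ultra hab
  exact ⟨⟨_, h.isCluster_contactSet hU⟩, ⟨_, h.isCluster_contactSet hV⟩,
    h.subset_contactSet hU haU, h.subset_contactSet hV hbV,
    (h.related_contactSet_iff hU hV).2 hUV⟩

theorem IsClan.mem_or_compl_mem {Γ : Set B} (hΓ : IsClan Ct Γ) (a : B) : a ∈ Γ ∨ aᶜ ∈ Γ :=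
  hΓ.prime _ _ (by rw [sup_compl_eq_top]; exact hΓ.top_mem)

/-- There are enough clusters: nonzero elements lie in clusters, elements in time contact lie in a
common one, and elements in precedence lie in related ones. The condition is applied to these, and
`p` or `pᶜ` lies in the cluster it yields. -/
theorem IsDCA.algHolds_of_timeHolds (h : IsDCA Cs Ct Bp) {φ : TimeAxiom}
    (hφ : φ.TimeHolds (fun Γ Δ : {Γ : Set B // IsCluster Ct Γ} => Related Bp Γ.1 Δ.1)) :
    φ.AlgHolds Ct Bp := by
  have hB := h.precontact
  cases φ <;> simp only [TimeAxiom.TimeHolds] at hφ <;> simp only [TimeAxiom.AlgHolds]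
  case rs =>
    intro a ha
    obtain ⟨Γ, haΓ⟩ := h.exists_cluster_of_ne_bot ha
    obtain ⟨Δ, hΔ⟩ := hφ Γ
    exact hΔ _ haΓ _ Δ.2.top_mem
  case ls =>
    intro a ha
    obtain ⟨Γ, haΓ⟩ := h.exists_cluster_of_ne_bot ha
    obtain ⟨Δ, hΔ⟩ := hφ Γ
    exact hΔ _ Δ.2.top_mem _ haΓ
  case upDir =>
    intro a b p ha hb
    obtain ⟨Γ, haΓ⟩ := h.exists_cluster_of_ne_bot ha
    obtain ⟨Δ, hbΔ⟩ := h.exists_cluster_of_ne_bot hb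
    obtain ⟨Λ, h1, h2⟩ := hφ Γ Δ
    exact (Λ.2.mem_or_compl_mem p).imp (h1 _ haΓ _) (h2 _ hbΔ _)
  case downDir =>
    intro a b p ha hb
    obtain ⟨Γ, haΓ⟩ := h.exists_cluster_of_ne_bot ha
    obtain ⟨Δ, hbΔ⟩ := h.exists_cluster_of_ne_bot hb
    obtain ⟨Λ, h1, h2⟩ := hφ Γ Δ
    exact (Λ.2.mem_or_compl_mem p).imp (fun hp => h1 _ hp _ haΓ) (fun hp => h2 _ hp _ hbΔ)
  case circ =>
    intro a b p hab
    obtain ⟨Γ, Δ, ha, hb, hΓΔ⟩ := h.exists_cluster_of_prec hab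
    obtain ⟨Λ, h1, h2⟩ := hφ Γ Δ hΓΔ
    exact (Λ.2.mem_or_compl_mem p).imp (h1 _ hb _) (fun hp => h2 _ hp _ ha)
  case dens =>
    intro a b p hab
    obtain ⟨Γ, Δ, ha, hb, hΓΔ⟩ := h.exists_cluster_of_prec hab
    obtain ⟨Λ, h1, h2⟩ := hφ Γ Δ hΓΔ
    exact (Λ.2.mem_or_compl_mem p).imp (h1 _ ha _) (fun hp => h2 _ hp _ hb)
  case ref =>
    intro a b hab
    obtain ⟨Γ, hΓ, ha, hb⟩ := h.exists_cluster_of_contact hab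
    exact hφ ⟨Γ, hΓ⟩ _ ha _ hb
  case lin =>
    intro a b ha hb
    obtain ⟨Γ, haΓ⟩ := h.exists_cluster_of_ne_bot ha
    obtain ⟨Δ, hbΔ⟩ := h.exists_cluster_of_ne_bot hb
    exact (hφ Γ Δ).imp (fun hr => hr _ haΓ _ hbΔ) (fun hr => hr _ hbΔ _ haΓ)
  case tri =>
    intro a b ha hb
    obtain ⟨Γ, haΓ⟩ := h.exists_cluster_of_ne_bot ha
    obtain ⟨Δ, hbΔ⟩ := h.exists_cluster_of_ne_bot hb
    exact (hφ Γ Δ).imp (fun he : Γ = Δ => Γ.2.contact _ _ haΓ (he ▸ hbΔ))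
      (Or.imp (fun hr => hr _ haΓ _ hbΔ) (fun hr => hr _ hbΔ _ haΓ))
  case tr =>
    intro a b hab
    by_contra! hn
    -- If no `c` interpolates, the successors of `a` and the predecessors of `b` share an
    -- ultrafilter `W`. Extending `a` to its left and `b` to its right gives a chain of three
    -- clusters, to which transitivity applies.
    obtain ⟨W, hW, h1, h2⟩ :=
      (hB.isGrill_right a).exists_ultra_inter (hB.isGrill_left b)
        fun c => (em (Bp a c)).imp_right (hn c)
    obtain ⟨U, hU, ha, hUW⟩ := hB.exists_left hW h1
    obtain ⟨V, hV, hb, hWV⟩ := hB.exists_right hW h2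
    have hUV : Related Bp (contactSet Ct U) (contactSet Ct V) :=
      hφ ⟨_, h.isCluster_contactSet hU⟩ ⟨_, h.isCluster_contactSet hW⟩
        ⟨_, h.isCluster_contactSet hV⟩
        ((h.related_contactSet_iff hU hW).2 hUW) ((h.related_contactSet_iff hW hV).2 hWV)
    exact hab (hUV _ (h.subset_contactSet hU ha) _ (h.subset_contactSet hV hb))

theorem TimeAxiom.TimeHolds.of_equiv {T T' : Type u} {r : T → T → Prop} {r' : T' → T' → Prop}
    (e : T ≃ T') (he : ∀ x y, r x y ↔ r' (e x) (e y)) {φ : TimeAxiom} (hφ : φ.TimeHolds r) :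
    φ.TimeHolds r' := by
  have hr : r = fun x y => r' (e x) (e y) := by
    funext x y; exact propext (he x y)
  subst hr
  cases φ <;> simp only [TimeAxiom.TimeHolds] at hφ ⊢ <;>
    simpa only [← e.forall_congr_right (q := _), ← e.exists_congr_right, e.apply_eq_iff_eq] using hφ

end Correspondence

/-! ### Transport along isomorphisms -/

section Transport

variable {B B' : Type u} [BooleanAlgebra B] [BooleanAlgebra B'] (e : B' ≃o B)
  {C Cs Ct Bp : B → B → Prop}

theorem IsPrecontact.comap (h : IsPrecontact C) : IsPrecontact fun x y => C (e x) (e y) where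
  ne_bot a b hab := by
    have := h.ne_bot _ _ hab
    exact ⟨fun ha => this.1 (by rw [ha, map_bot]), fun hb => this.2 (by rw [hb, map_bot])⟩
  mono _ _ _ _ hab h1 h2 := h.mono _ _ _ _ hab (e.monotone h1) (e.monotone h2)
  sup_right a b c habc := h.sup_right _ _ _ (by rwa [map_sup] at habc)
  sup_left a b c habc := h.sup_left _ _ _ (by rwa [map_sup] at habc)

theorem IsContact.comap (h : IsContact C) : IsContact fun x y => C (e x) (e y) where
  toIsPrecontact := h.toIsPrecontact.comap e
  symm _ _ hab := h.symm _ _ hab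
  overlap a b hab := h.overlap _ _ fun hn => hab (e.injective (by rw [map_inf, hn, map_bot]))

theorem IsDCA.comap (h : IsDCA Cs Ct Bp) :
    IsDCA (fun x y => Cs (e x) (e y)) (fun x y => Ct (e x) (e y))
      (fun x y => Bp (e x) (e y)) where
  nondegenerate hn := h.nondegenerate (by rw [← map_bot e, hn, map_top])
  contact_space := h.contact_space.comap e
  contact_time := h.contact_time.comap e
  space_le_time _ _ hab := h.space_le_time _ _ hab
  efremovich a b hab := by
    obtain ⟨c, h1, h2⟩ := h.efremovich _ _ hab
    exact ⟨e.symm c, by rwa [e.apply_symm_apply], by rwa [map_compl', e.apply_symm_apply]⟩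
  precontact := h.precontact.comap e
  time_prec a b hab := by
    obtain ⟨c, h1, h2⟩ := h.time_prec _ _ hab
    exact ⟨e.symm c, by rwa [e.apply_symm_apply], by rwa [map_compl', e.apply_symm_apply]⟩
  prec_time a b hab := by
    obtain ⟨c, h1, h2⟩ := h.prec_time _ _ hab
    exact ⟨e.symm c, by rwa [e.apply_symm_apply], by rwa [map_compl', e.apply_symm_apply]⟩

theorem IsClan.comap {Γ : Set B} (h : IsClan C Γ) :
    IsClan (fun x y => C (e x) (e y)) (e ⁻¹' Γ) where
  top_mem := by rw [Set.mem_preimage, map_top]; exact h.top_mem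
  bot_notMem := by rw [Set.mem_preimage, map_bot]; exact h.bot_notMem
  up _ _ ha hab := h.up _ _ ha (e.monotone hab)
  prime a b hab := h.prime _ _ (by rwa [Set.mem_preimage, map_sup] at hab)
  contact _ _ ha hb := h.contact _ _ ha hb

theorem IsCluster.comap {Γ : Set B} (h : IsCluster C Γ) :
    IsCluster (fun x y => C (e x) (e y)) (e ⁻¹' Γ) where
  toIsClan := h.toIsClan.comap e
  cluster a ha := by
    obtain ⟨b, hb, hab⟩ := h.cluster _ ha
    exact ⟨e.symm b, by rwa [Set.mem_preimage, e.apply_symm_apply],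
      by rwa [e.apply_symm_apply]⟩

end Transport

/-! ### The dual algebra functor -/

section DualFunctor

/-- The homomorphism of dual algebras given by preimages. -/
noncomputable def DMSHom.preimage {S S' : DMS.{u}} (f : DMSHom S S') :
    BoundedLatticeHom S'.M S.M := f.preimage_hom.choose

/-- This formula determines the chosen homomorphism, since a regular closed set is determined by its
points; the choice therefore does not affect functoriality. -/
theorem DMSHom.preimage_set {S S' : DMS.{u}} (f : DMSHom S S') (a : S'.M) :
    (f.preimage a).1.set = f.toFun ⁻¹' a.1.set := f.preimage_hom.choose_spec a

theorem DMSHom.mem_preimage {S S' : DMS.{u}} (f : DMSHom S S') (a : S'.M) (x : S.Xt) :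
    x ∈ (f.preimage a).1.set ↔ f.toFun x ∈ a.1.set := by
  rw [f.preimage_set]; rfl

/-- The dual of a DMS-morphism. -/
noncomputable def DMSHom.dual {S S' : DMS.{u}} (f : DMSHom S S') : DCAHom S'.dual S.dual where
  toHom := f.preimage
  reflect_space a b := by
    rintro ⟨x, ⟨ha, hb⟩, hx⟩
    exact ⟨f.toFun x, ⟨(f.mem_preimage _ _).1 ha, (f.mem_preimage _ _).1 hb⟩, f.map_Xs x hx⟩
  reflect_time a b := by
    rintro ⟨x, ha, hb⟩
    exact ⟨f.toFun x, (f.mem_preimage _ _).1 ha, (f.mem_preimage _ _).1 hb⟩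
  reflect_prec a b := by
    rintro ⟨x, y, hxy, hx, hy⟩
    exact ⟨f.toFun x, f.toFun y, f.map_prec _ _ hxy, (f.mem_preimage _ _).1 hx,
      (f.mem_preimage _ _).1 hy⟩

theorem DCAHom.ext_dual {A : DCA.{u}} {S : DMS.{u}} {f g : DCAHom A S.dual}
    (h : ∀ a x, x ∈ (f.toHom a : S.M).1.set ↔ x ∈ (g.toHom a : S.M).1.set) : f = g :=
  DCAHom.ext (DFunLike.ext _ _ fun a => Subtype.ext (RegClosed.ext_set (Set.ext (h a))))

/-- The contravariant functor of dual algebras. -/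
noncomputable def dualFunctor : DMS.{u}ᵒᵖ ⥤ DCA.{u} where
  obj S := S.unop.dual
  map f := DMSHom.dual f.unop
  map_id S := DCAHom.ext_dual fun a x => DMSHom.mem_preimage (𝟙 S.unop : S.unop ⟶ S.unop) a x
  map_comp f g := DCAHom.ext_dual fun a x =>
    (DMSHom.mem_preimage (f ≫ g).unop a x).trans
      (((DMSHom.mem_preimage g.unop _ x).trans (DMSHom.mem_preimage f.unop a _)).symm)

end DualFunctor

/-! ### Points of a space and clans of its dual algebra -/

section Points

namespace DMS

variable (S : DMS.{u})

theorem isClan_rho (x : S.Xt) : IsClan S.dual.Ct (S.rho x) where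
  top_mem := Set.mem_univ x
  bot_notMem := Set.notMem_empty x
  up _ _ ha hab := hab ha
  prime _ _ h := h
  contact _ _ ha hb := ⟨x, ha, hb⟩

theorem isClan_space_rho {x : S.Xt} (hx : x ∈ S.Xs) : IsClan S.dual.Cs (S.rho x) :=
  { S.isClan_rho x with contact := fun _ _ ha hb => ⟨x, ⟨ha, hb⟩, hx⟩ }

theorem rho_injective [T0Space S.Xt] : Function.Injective S.rho := by
  intro x y hxy
  refine (S.closed_base.inseparable_iff.2 ?_).eq
  rintro _ ⟨a, ha, rfl⟩
  exact not_congr (Set.ext_iff.1 hxy (⟨a, ha⟩ : S.M))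

theorem prec_iff_related (x y : S.Xt) : S.prec x y ↔ Related S.dual.Bp (S.rho x) (S.rho y) :=
  (S.prec_iff x y).trans
    ⟨fun h a ha b hb => h a b ha hb, fun h a b ha hb => h a ha b hb⟩

/-- In a T0 and DM-compact space the time points are the clusters of the dual algebra. -/
noncomputable def timeEquiv [T0Space S.Xt] (hS : S.IsDMCompact) :
    S.T ≃ {Γ : Set S.dual.carrier // IsCluster S.dual.Ct Γ} :=
  Equiv.ofBijective (fun x => ⟨S.rho x.1, S.cluster_of_mem_T x.1 x.2⟩)
    ⟨fun _ _ h => Subtype.ext (S.rho_injective (congrArg Subtype.val h)), fun ⟨Γ, hΓ⟩ => by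
      obtain ⟨x, hx, rfl⟩ := hS.cluster Γ hΓ
      exact ⟨⟨x, hx⟩, rfl⟩⟩

theorem dcaSat_dual {Ax : Set TimeAxiom} (hS : DMSSat Ax S) : DCASat Ax S.dual := by
  obtain ⟨hT, hc, hAx⟩ := hS
  exact fun φ hφ => S.dual.isDCA.algHolds_of_timeHolds
    ((hAx φ hφ).of_equiv (S.timeEquiv hc) fun x y => S.prec_iff_related x y)

end DMS

theorem IsClan.preimage {A A' : DCA.{u}} (f : DCAHom A A') {C : A.carrier → A.carrier → Prop}
    {C' : A'.carrier → A'.carrier → Prop} (hf : ∀ a b, C' (f.toHom a) (f.toHom b) → C a b)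
    {Γ : Set A'.carrier} (h : IsClan C' Γ) : IsClan C (f.toHom ⁻¹' Γ) where
  top_mem := by rw [Set.mem_preimage, map_top]; exact h.top_mem
  bot_notMem := by rw [Set.mem_preimage, map_bot]; exact h.bot_notMem
  up _ _ ha hab := h.up _ _ ha (OrderHomClass.mono f.toHom hab)
  prime a b hab := h.prime _ _ (by rwa [Set.mem_preimage, map_sup] at hab)
  contact _ _ ha hb := hf _ _ (h.contact _ _ ha hb)

theorem DMSHom.dual_injective {S S' : DMS.{u}} [T0Space S'.Xt] {f g : DMSHom S S'}
    (h : f.dual = g.dual) : f = g := by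
  refine DMSHom.ext (funext fun x => S'.rho_injective (Set.ext fun a => ?_))
  have ha : f.preimage a = g.preimage a :=
    congrArg (fun k : DCAHom S'.dual S.dual => k.toHom a) h
  have hf := f.mem_preimage a x
  rw [ha] at hf
  exact hf.symm.trans (g.mem_preimage a x)

/-- The image of a point `x` is the point representing the t-clan `k⁻¹(rho x)`. -/
theorem DMSHom.dual_surjective {S S' : DMS.{u}} [T0Space S'.Xt] (hS' : S'.IsDMCompact)
    (k : DCAHom S'.dual S.dual) : ∃ f : DMSHom S S', f.dual = k := by
  choose t ht using fun x : S.Xt =>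
    hS'.t_clan _ ((S.isClan_rho x).preimage k k.reflect_time)
  have hmem : ∀ (a : S'.M) x, x ∈ (k.toHom a : S.M).1.set ↔ t x ∈ a.1.set :=
    fun a x => Set.ext_iff.1 (ht x) a
  refine ⟨⟨t, fun x hx => ?_, fun x y hxy => ?_, k.toHom, fun a => Set.ext (hmem a)⟩,
    DCAHom.ext_dual fun a x => (DMSHom.mem_preimage _ a x).trans (hmem a x).symm⟩
  -- The same preimage is an s-clan when `x` is a space point, so a space point also represents it;
  -- by T0 that point is `t x`.
  · obtain ⟨y, hy, hxy⟩ := hS'.s_clan _ ((S.isClan_space_rho hx).preimage k k.reflect_space)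
    rwa [S'.rho_injective ((ht x).symm.trans hxy)]
  · rw [DMS.prec_iff_related] at hxy ⊢
    rw [← ht, ← ht]
    exact fun a ha b hb => k.reflect_prec _ _ (hxy _ ha _ hb)

end Points

/-! ### The canonical space of a dynamic contact algebra -/

section Canonical

/-- The points of the canonical space: the t-clans of the algebra. -/
def TClan (A : DCA.{u}) : Type u := {Γ : Set A.carrier // IsClan A.Ct Γ}

variable {A : DCA.{u}}

/-- The t-clan of an ultrafilter. -/
def TClan.ofUltra {U : Set A.carrier} (hU : IsUltra U) : TClan A :=
  ⟨U, A.isDCA.contact_time.isClan_of_isUltra hU⟩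

/-- The set of t-clans that contain `a`. -/
def stone (a : A.carrier) : Set (TClan A) := {Γ | a ∈ Γ.1}

instance : TopologicalSpace (TClan A) :=
  TopologicalSpace.generateFrom {U | ∃ a, U = (stone a)ᶜ}

theorem stone_bot : stone (⊥ : A.carrier) = ∅ :=
  Set.eq_empty_of_forall_notMem fun Γ => Γ.2.bot_notMem

theorem stone_top : stone (⊤ : A.carrier) = Set.univ :=
  Set.eq_univ_of_forall fun Γ => Γ.2.top_mem

theorem stone_sup (a b : A.carrier) : stone (a ⊔ b) = stone a ∪ stone b :=
  Set.ext fun Γ => ⟨Γ.2.prime a b, fun h =>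
    h.elim (fun h => Γ.2.up _ _ h le_sup_left) (fun h => Γ.2.up _ _ h le_sup_right)⟩

/-- If `a ≰ b`, an ultrafilter containing `a ⊓ bᶜ` is a t-clan containing `a` but not `b`. -/
theorem stone_subset_iff {a b : A.carrier} : stone a ⊆ stone b ↔ a ≤ b := by
  refine ⟨fun h => ?_, fun h Γ ha => Γ.2.up _ _ ha h⟩
  by_contra hab
  rw [← disjoint_compl_right_iff, disjoint_iff] at hab
  obtain ⟨U, hU, haU⟩ := exists_ultra_of_ne_bot hab
  have hb : b ∈ U := @h (TClan.ofUltra hU) (hU.up _ _ haU inf_le_left)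
  exact hU.bot_notMem (by simpa using hU.inf_mem _ _ hb (hU.up _ _ haU inf_le_right))

theorem isTopologicalBasis_stone :
    TopologicalSpace.IsTopologicalBasis {U : Set (TClan A) | ∃ a, U = (stone a)ᶜ} := by
  refine TopologicalSpace.isTopologicalBasis_of_subbasis_of_finiteInter rfl ⟨?_, ?_⟩
  · exact ⟨⊥, by rw [stone_bot, Set.compl_empty]⟩
  · rintro _ ⟨a, rfl⟩ _ ⟨b, rfl⟩
    exact ⟨a ⊔ b, by rw [stone_sup, Set.compl_union]⟩

theorem isOpen_compl_stone (a : A.carrier) : IsOpen (stone a)ᶜ :=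
  isTopologicalBasis_stone.isOpen ⟨a, rfl⟩

theorem closure_compl_stone (a : A.carrier) : closure (stone a)ᶜ = stone aᶜ := by
  refine subset_antisymm (closure_minimal
    (fun Γ hΓ => (Γ.2.mem_or_compl_mem a).resolve_left hΓ)
    (isOpen_compl_iff.1 (isOpen_compl_stone _))) fun Γ hΓ => ?_
  rw [isTopologicalBasis_stone.mem_closure_iff]
  rintro _ ⟨b, rfl⟩ hb
  by_contra hn
  -- A basic neighbourhood `(stone b)ᶜ` missing `(stone a)ᶜ` forces `a ⊔ b = ⊤`, hence `aᶜ ≤ b`, so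
  -- a clan containing `aᶜ` lies outside that neighbourhood.
  refine hb (stone_subset_iff.2 (?_ : aᶜ ≤ b) hΓ)
  rw [← codisjoint_iff_compl_le_right, codisjoint_iff, ← top_le_iff,
    ← stone_subset_iff, stone_sup]
  intro Δ _
  by_contra hΔ
  exact hn ⟨Δ, fun h => hΔ (Or.inr h), fun h => hΔ (Or.inl h)⟩

theorem regular_stone (a : A.carrier) : closure (interior (stone a)) = stone a := by
  rw [← compl_compl a, ← closure_compl_stone]
  exact regular_closure_of_isOpen (isOpen_compl_stone _)

/-- The regular closed set of the t-clans that contain `a`. -/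
def stoneRC (a : A.carrier) : RegClosed (TClan A) := ⟨stone a, regular_stone a⟩

theorem stoneRC_le_iff {a b : A.carrier} : stoneRC a ≤ stoneRC b ↔ a ≤ b := stone_subset_iff

theorem stoneRC_sup (a b : A.carrier) : stoneRC (a ⊔ b) = stoneRC a ⊔ stoneRC b :=
  RegClosed.ext_set (stone_sup a b)

theorem stoneRC_compl (a : A.carrier) : stoneRC aᶜ = (stoneRC a)ᶜ :=
  RegClosed.ext_set (closure_compl_stone a).symm

theorem stoneRC_bot : stoneRC (⊥ : A.carrier) = ⊥ := RegClosed.ext_set stone_bot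

/-- De Morgan reduces this to joins and complements. A direct computation is unavailable, because a
clan may contain two elements without containing their meet. -/
theorem stoneRC_inf (a b : A.carrier) : stoneRC (a ⊓ b) = stoneRC a ⊓ stoneRC b := by
  rw [← compl_compl (a ⊓ b), compl_inf, stoneRC_compl, stoneRC_sup, stoneRC_compl,
    stoneRC_compl, compl_sup, compl_compl, compl_compl]

variable (A) in
/-- The regular closed sets of the canonical space that come from elements of the algebra. -/
def stoneSubalgebra : BooleanSubalgebra (RegClosed (TClan A)) where
  carrier := Set.range stoneRC
  supClosed' := by
    rintro _ ⟨a, rfl⟩ _ ⟨b, rfl⟩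
    exact ⟨_, stoneRC_sup a b⟩
  infClosed' := by
    rintro _ ⟨a, rfl⟩ _ ⟨b, rfl⟩
    exact ⟨_, stoneRC_inf a b⟩
  compl_mem' := by
    rintro _ ⟨a, rfl⟩
    exact ⟨_, stoneRC_compl a⟩
  bot_mem' := ⟨_, stoneRC_bot⟩

variable (A) in
/-- The algebra is isomorphic to an algebra of regular closed sets. -/
noncomputable def stoneIso : A.carrier ≃o stoneSubalgebra A where
  toEquiv := Equiv.ofBijective (fun a => ⟨stoneRC a, a, rfl⟩)
    ⟨fun _ _ h => le_antisymm (stoneRC_le_iff.1 (congrArg Subtype.val h).le)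
      (stoneRC_le_iff.1 (congrArg Subtype.val h).ge), fun ⟨_, a, h⟩ => ⟨a, Subtype.ext h⟩⟩
  map_rel_iff' := stoneRC_le_iff

/-- The space points of the canonical space: the s-clans of the algebra. -/
def spacePoints (A : DCA.{u}) : Set (TClan A) := {Γ | IsClan A.Cs Γ.1}

/-- The before-after relation of the canonical space. -/
def clanPrec (Γ Δ : TClan A) : Prop := Related A.Bp Γ.1 Δ.1

theorem timeContact_stoneRC (a b : A.carrier) :
    timeContact (stoneRC a) (stoneRC b) ↔ A.Ct a b := by
  refine ⟨fun ⟨Γ, ha, hb⟩ => Γ.2.contact _ _ ha hb, fun h => ?_⟩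
  obtain ⟨Γ, hΓ, ha, hb⟩ := A.isDCA.contact_time.exists_clan h
  exact ⟨⟨Γ, hΓ⟩, ha, hb⟩

theorem spaceContact_stoneRC (a b : A.carrier) :
    spaceContact (spacePoints A) (stoneRC a) (stoneRC b) ↔ A.Cs a b := by
  refine ⟨fun ⟨Γ, ⟨ha, hb⟩, hΓ⟩ => hΓ.contact _ _ ha hb, fun h => ?_⟩
  obtain ⟨Γ, hΓ, ha, hb⟩ := A.isDCA.contact_space.exists_clan h
  exact ⟨⟨Γ, hΓ.of_le A.isDCA.space_le_time⟩, ⟨ha, hb⟩, hΓ⟩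

/-- Ultrafilters are t-clans, so they already supply enough points to witness precedence. -/
theorem precedence_stoneRC (a b : A.carrier) :
    precedence clanPrec (stoneRC a) (stoneRC b) ↔ A.Bp a b := by
  refine ⟨fun ⟨Γ, Δ, h, ha, hb⟩ => h _ ha _ hb, fun h => ?_⟩
  obtain ⟨U, V, hU, hV, ha, hb, hUV⟩ := A.isDCA.precontact.exists_ultra h
  exact ⟨.ofUltra hU, .ofUltra hV, hUV, ha, hb⟩

theorem stoneRC_symm (x : stoneSubalgebra A) : stoneRC ((stoneIso A).symm x) = x.1 :=
  congrArg Subtype.val ((stoneIso A).apply_symm_apply x)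

theorem timeContact_eq_comap :
    (fun x y : stoneSubalgebra A => timeContact x.1 y.1) =
      fun x y => A.Ct ((stoneIso A).symm x) ((stoneIso A).symm y) := by
  funext x y
  rw [← timeContact_stoneRC, stoneRC_symm, stoneRC_symm]

theorem spaceContact_eq_comap :
    (fun x y : stoneSubalgebra A => spaceContact (spacePoints A) x.1 y.1) =
      fun x y => A.Cs ((stoneIso A).symm x) ((stoneIso A).symm y) := by
  funext x y
  rw [← spaceContact_stoneRC, stoneRC_symm, stoneRC_symm]

theorem precedence_eq_comap :
    (fun x y : stoneSubalgebra A => precedence clanPrec x.1 y.1) =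
      fun x y => A.Bp ((stoneIso A).symm x) ((stoneIso A).symm y) := by
  funext x y
  rw [← precedence_stoneRC, stoneRC_symm, stoneRC_symm]

theorem setOf_mem_eq_preimage (Γ : TClan A) :
    {x : stoneSubalgebra A | Γ ∈ x.1.set} = (stoneIso A).symm ⁻¹' Γ.1 := by
  ext x
  rw [Set.mem_ofPred_eq, ← stoneRC_symm]
  rfl

theorem ofUltra_mem_spacePoints {U : Set A.carrier} (hU : IsUltra U) :
    TClan.ofUltra hU ∈ spacePoints A := A.isDCA.contact_space.isClan_of_isUltra hU

variable (A) in
theorem exists_cluster : ∃ Γ : Set A.carrier, IsCluster A.Ct Γ := by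
  obtain ⟨Γ, -⟩ := A.isDCA.exists_cluster_of_ne_bot A.isDCA.nondegenerate.symm
  exact ⟨Γ.1, Γ.2⟩

/-- A nonempty regular closed set has nonempty interior, which contains a nonempty basic open set
`(stone b)ᶜ`. Then `bᶜ ≠ ⊥`, and an ultrafilter containing `bᶜ` is an s-clan in that open set. -/
theorem exists_spacePoint {a : RegClosed (TClan A)} (ha : a.set.Nonempty) :
    (a.set ∩ spacePoints A).Nonempty := by
  rw [← a.regular, closure_nonempty_iff] at ha
  obtain ⟨Γ, hΓ⟩ := ha
  obtain ⟨_, ⟨b, rfl⟩, hb, hsub⟩ :=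
    isTopologicalBasis_stone.exists_subset_of_mem_open hΓ isOpen_interior
  have hne : bᶜ ≠ ⊥ := fun h => hb (by
    rw [compl_eq_bot.1 h, stone_top]; trivial)
  obtain ⟨U, hU, hbU⟩ := exists_ultra_of_ne_bot hne
  refine ⟨.ofUltra hU, interior_subset (hsub fun h => ?_), ofUltra_mem_spacePoints hU⟩
  exact hU.bot_notMem (by simpa using hU.inf_mem _ _ h hbU)

/-- The canonical space of a dynamic contact algebra. -/
def DCA.canonicalSpace (A : DCA.{u}) : DMS.{u} where
  Xt := TClan A
  nonempty := (exists_cluster A).elim fun Γ hΓ => ⟨⟨Γ, hΓ.toIsClan⟩⟩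
  Xs := spacePoints A
  T := {Γ | IsCluster A.Ct Γ.1}
  prec := clanPrec
  M := stoneSubalgebra A
  closed_base := by
    convert isTopologicalBasis_stone (A := A) using 1
    ext U
    constructor
    · rintro ⟨_, ⟨a, rfl⟩, rfl⟩
      exact ⟨a, rfl⟩
    · rintro ⟨a, rfl⟩
      exact ⟨_, ⟨a, rfl⟩, rfl⟩
  Xs_nonempty := by
    obtain ⟨U, hU, -⟩ := exists_ultra_of_ne_bot A.isDCA.nondegenerate.symm
    exact ⟨_, ofUltra_mem_spacePoints hU⟩
  T_nonempty := (exists_cluster A).elim fun Γ hΓ => ⟨⟨Γ, hΓ.toIsClan⟩, hΓ⟩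
  inter_Xs _ ha := exists_spacePoint ha
  isDCA := by
    rw [timeContact_eq_comap, spaceContact_eq_comap, precedence_eq_comap]
    exact A.isDCA.comap (stoneIso A).symm
  prec_iff Γ Δ := by
    refine ⟨fun h a b ha hb => ⟨Γ, Δ, h, ha, hb⟩, fun h a ha b hb => ?_⟩
    exact (precedence_stoneRC a b).1 (h (stoneIso A a) (stoneIso A b) ha hb)
  cluster_of_mem_T Γ hΓ := by
    rw [timeContact_eq_comap, setOf_mem_eq_preimage]
    exact IsCluster.comap (stoneIso A).symm hΓ

theorem dual_Ct_stoneIso (a b : A.carrier) :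
    A.canonicalSpace.dual.Ct (stoneIso A a) (stoneIso A b) ↔ A.Ct a b := timeContact_stoneRC a b

theorem dual_Cs_stoneIso (a b : A.carrier) :
    A.canonicalSpace.dual.Cs (stoneIso A a) (stoneIso A b) ↔ A.Cs a b := spaceContact_stoneRC a b

theorem dual_Bp_stoneIso (a b : A.carrier) :
    A.canonicalSpace.dual.Bp (stoneIso A a) (stoneIso A b) ↔ A.Bp a b := precedence_stoneRC a b

theorem eq_rho_of_preimage_eq {Γ : Set (stoneSubalgebra A)} {Δ : TClan A}
    (h : stoneIso A ⁻¹' Γ = Δ.1) : Γ = A.canonicalSpace.rho Δ := by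
  refine Eq.trans ?_ (setOf_mem_eq_preimage Δ).symm
  rw [← h, ← Set.preimage_comp]
  ext x
  rw [Set.mem_preimage, Function.comp_apply, OrderIso.apply_symm_apply]

theorem isClan_time_preimage {Γ : Set (stoneSubalgebra A)}
    (h : IsClan A.canonicalSpace.dual.Ct Γ) : IsClan A.Ct (stoneIso A ⁻¹' Γ) :=
  (IsClan.comap (stoneIso A) h).of_le fun a b => (dual_Ct_stoneIso a b).1

theorem isDMCompact_canonicalSpace (A : DCA.{u}) : A.canonicalSpace.IsDMCompact where
  t_clan Γ hΓ := ⟨⟨_, isClan_time_preimage hΓ⟩, eq_rho_of_preimage_eq rfl⟩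
  s_clan Γ hΓ := by
    have h : IsClan A.Cs (stoneIso A ⁻¹' Γ) :=
      (IsClan.comap (stoneIso A) hΓ).of_le fun a b => (dual_Cs_stoneIso a b).1
    exact ⟨⟨_, h.of_le A.isDCA.space_le_time⟩, h, eq_rho_of_preimage_eq rfl⟩
  cluster Γ hΓ := by
    refine ⟨⟨_, isClan_time_preimage hΓ.toIsClan⟩, ?_, eq_rho_of_preimage_eq rfl⟩
    refine ⟨isClan_time_preimage hΓ.toIsClan, fun a ha => ?_⟩
    obtain ⟨b, hb, hab⟩ := (IsCluster.comap (stoneIso A) hΓ).cluster a ha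
    exact ⟨b, hb, fun h => hab ((dual_Ct_stoneIso a b).2 h)⟩

instance : T0Space (TClan A) where
  t0 Γ Δ h := by
    refine Subtype.ext (Set.ext fun a => not_iff_not.1 ?_)
    exact isTopologicalBasis_stone.inseparable_iff.1 h _ ⟨a, rfl⟩

/-- The time points of the canonical space are the clusters. -/
def clusterEquiv (A : DCA.{u}) :
    {Γ : Set A.carrier // IsCluster A.Ct Γ} ≃ A.canonicalSpace.T where
  toFun Γ := ⟨⟨Γ.1, Γ.2.toIsClan⟩, Γ.2⟩
  invFun Γ := ⟨Γ.1.1, Γ.2⟩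
  left_inv _ := rfl
  right_inv _ := rfl

theorem dmsSat_canonicalSpace {Ax : Set TimeAxiom} (hA : DCASat Ax A) :
    DMSSat Ax A.canonicalSpace :=
  ⟨inferInstanceAs (T0Space (TClan A)), isDMCompact_canonicalSpace A, fun φ hφ =>
    (A.isDCA.timeHolds_of_algHolds (hA φ hφ)).of_equiv (clusterEquiv A) fun _ _ => Iff.rfl⟩

/-- A dynamic contact algebra is isomorphic to the dual of its canonical space. -/
noncomputable def dualCanonicalIso (A : DCA.{u}) : A.canonicalSpace.dual ≅ A where
  hom := DCAHom.mk (A := A.canonicalSpace.dual) (A' := A)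
    ((stoneIso A).symm : BoundedLatticeHom (stoneSubalgebra A) A.carrier)
    (fun a b h => (congrFun₂ spaceContact_eq_comap a b).mpr h)
    (fun a b h => (congrFun₂ timeContact_eq_comap a b).mpr h)
    (fun a b h => (congrFun₂ precedence_eq_comap a b).mpr h)
  inv := DCAHom.mk (A := A) (A' := A.canonicalSpace.dual)
    (stoneIso A : BoundedLatticeHom A.carrier (stoneSubalgebra A))
    (fun a b => (dual_Cs_stoneIso a b).1) (fun a b => (dual_Ct_stoneIso a b).1)
    (fun a b => (dual_Bp_stoneIso a b).1)
  hom_inv_id := DCAHom.ext (DFunLike.ext _ _ fun x => (stoneIso A).apply_symm_apply x)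
  inv_hom_id := DCAHom.ext (DFunLike.ext _ _ fun a => (stoneIso A).symm_apply_apply a)

end Canonical

/-! ### The duality -/

section Duality

/-- The dual algebra functor between the full subcategories. -/
noncomputable def satDualFunctor (Ax : Set TimeAxiom) :
    (DMSSat.{u} Ax).FullSubcategoryᵒᵖ ⥤ (DCASat.{u} Ax).FullSubcategory :=
  (DCASat Ax).lift ((DMSSat Ax).ι.op ⋙ dualFunctor) fun S => S.unop.obj.dcaSat_dual S.unop.property

instance (Ax : Set TimeAxiom) : (satDualFunctor.{u} Ax).Faithful where
  map_injective {S S'} f g h := by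
    have : T0Space S.unop.obj.Xt := S.unop.property.1
    exact Quiver.Hom.unop_inj (ObjectProperty.hom_ext _
      (DMSHom.dual_injective (congrArg (fun k => k.hom) h)))

instance (Ax : Set TimeAxiom) : (satDualFunctor.{u} Ax).Full where
  map_surjective {S S'} k := by
    have : T0Space S.unop.obj.Xt := S.unop.property.1
    obtain ⟨f, hf⟩ := DMSHom.dual_surjective S.unop.property.2.1 k.hom
    exact ⟨Quiver.Hom.op (ObjectProperty.homMk f), ObjectProperty.hom_ext _ hf⟩

instance (Ax : Set TimeAxiom) : (satDualFunctor.{u} Ax).EssSurj where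
  mem_essImage A := ⟨Opposite.op ⟨A.obj.canonicalSpace, dmsSat_canonicalSpace A.property⟩,
    ⟨(DCASat Ax).isoMk (dualCanonicalIso A.obj)⟩⟩

instance (Ax : Set TimeAxiom) : (satDualFunctor.{u} Ax).IsEquivalence where

end Duality

end DynMereo

theorem mainTheorem5 (Ax : Set DynMereo.TimeAxiom) :
    Nonempty ((DynMereo.DCASat.{u} Ax).FullSubcategoryᵒᵖ ≌
      (DynMereo.DMSSat.{u} Ax).FullSubcategory) :=
  -- The functor starts from the opposite of the category of spaces; `rightOp` moves the opposite to
  -- the algebras and `symm` reverses the direction.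
  ⟨(DynMereo.satDualFunctor Ax).asEquivalence.rightOp.symm⟩
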